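/- Let $\mathbb N=\{1,2,\dots\}$. For each countable limit ordinal $\beta$ fix a non-decreasing sequence $(\alpha_n^{\beta})_{n\in\mathbb N}$ of ordinals $<\beta$ with supremum $\beta$; the theorem holds for every such choice. For non-empty finite $A,B\subset\mathbb N$ and $n\in\mathbb N$ write $n\le A<B$ if $n\le\min A\le\max A<\min B$. For countable ordinals $\alpha$ the Schreier families $\mathrm S_\alpha$ of finite subsets of $\mathbb N$ are defined recursively by $$\mathrm S_0=\{\{n\}:n\in\mathbb N\},\qquad \mathrm S_{\alpha+1}=\Big\{\bigcup_{j=1}^nE_j:\ n\in\mathbb N,\ E_1,\dots,E_n\in\mathrm S_\alpha,\ n\le E_1<E_2<\dots<E_n\Big\},$$ $$\mathrm S_\beta=\{A:\ \exists n\in\mathbb N,\ n\le A\text{ and }A\in\mathrm S_{\alpha_n^\beta}\}\quad\text{for limit }\beta.$$ Let $\mathrm S_\alpha(\mathbb Q)=\{\sum_{i\in G}c_ie_i:\ G\in\mathrm S_\alpha,\ c_i\in\mathbb Q\}\subset c_0$, where $(e_i)$ is the unit vector basis of the real Banach space $c_0$, with the metric $d_\infty$ induced by $\|\cdot\|_\infty$.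 A metric space $X$ bi-Lipschitzly embeds into a metric space $Y$ if there are $s>0$, $D\ge1$ and $f\colon X\to Y$ with $s\,d_X(x,y)\le d_Y(f(x),f(y))\le sD\,d_X(x,y)$ for all $x,y\in X$. **Theorem A.** Let $M$ be a complete separable metric space such that $(\mathrm S_\alpha(\mathbb Q),d_\infty)$ bi-Lipschitzly embeds into $M$ for every countable ordinal $\alpha$. Then $M$ is Lipschitzly universal for the class of all separable metric spaces, i.e. every separable metric space bi-Lipschitzly embeds into $M$; in particular, $c_0$ bi-Lipschitzly embeds into $M$. -/

import Mathlib

open scoped ZeroAtInfty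

universe u v

/-- `X` bi-Lipschitzly embeds into `Y`: for some scaling factor `s > 0` and distortion `D ≥ 1`
there is a map `f : X → Y` with `s * d x y ≤ d (f x) (f y) ≤ s * D * d x y`. -/
def BiLipschitzEmbeds (X Y : Type*) [MetricSpace X] [MetricSpace Y] : Prop :=
  ∃ (s D : ℝ) (f : X → Y), 0 < s ∧ 1 ≤ D ∧
    ∀ x y : X, s * dist x y ≤ dist (f x) (f y) ∧ dist (f x) (f y) ≤ s * D * dist x y

/-- A choice, for every countable limit ordinal `β`, of a sequence of ordinals below `β` that
increases to `β`. (The values at other ordinals, and the term of index `0`, are never used.) -/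
def IsLadderSystem (a : Ordinal.{0} → ℕ → Ordinal.{0}) : Prop :=
  ∀ β : Ordinal.{0}, β < Ordinal.omega 1 → Order.IsSuccLimit β →
    Monotone (a β) ∧ (∀ n, a β n < β) ∧ ∀ γ < β, ∃ n, γ < a β n

/-- `SchreierMem a α A`: the finite set `A` belongs to the Schreier family of order `α` built with
the sequences `a β`, for limit `β`. The families consist of non-empty finite sets of positive
integers.
* order `0`: the singletons `{n}`, `n ≥ 1`;
* order `α + 1`: the unions `E₁ ∪ ⋯ ∪ Eₙ` with `n ≥ 1`, all `Eⱼ` of order `α` and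
  `n ≤ E₁ < E₂ < ⋯ < Eₙ`;
* limit order `β`: the sets `A` of order `a β n` with `n ≤ A`, for some `n ≥ 1`. -/
inductive SchreierMem (a : Ordinal.{0} → ℕ → Ordinal.{0}) : Ordinal.{0} → Finset ℕ → Prop
  | zero (n : ℕ) (hn : 1 ≤ n) : SchreierMem a 0 {n}
  | succ (α : Ordinal.{0}) (n : ℕ) (hn : 1 ≤ n) (E : Fin n → Finset ℕ)
      (hE : ∀ j, SchreierMem a α (E j))
      (hmin : ∀ j, ∀ m ∈ E j, n ≤ m)
      (hlt : ∀ i j, i < j → ∀ p ∈ E i, ∀ q ∈ E j, p < q) :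
      SchreierMem a (Order.succ α) (Finset.univ.biUnion E)
  | limit (β : Ordinal.{0}) (hβ : Order.IsSuccLimit β) (n : ℕ) (hn : 1 ≤ n) (A : Finset ℕ)
      (hmin : ∀ m ∈ A, n ≤ m) (hA : SchreierMem a (a β n) A) :
      SchreierMem a β A

/-- The Schreier family of order `α`. -/
def schreierFamily (a : Ordinal.{0} → ℕ → Ordinal.{0}) (α : Ordinal.{0}) : Set (Finset ℕ) :=
  {A | SchreierMem a α A}

/-- The set of the vectors `∑ i ∈ G, c i • e i` of `c₀` with `G ∈ 𝓖` and all `c i ∈ E`. As a subtype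
of `c₀ = C₀(ℕ, ℝ)` it carries the metric of the supremum norm. -/
def familySpace (𝓖 : Set (Finset ℕ)) (E : Set ℝ) : Set C₀(ℕ, ℝ) :=
  {x | ∃ G ∈ 𝓖, (∀ i ∈ G, x i ∈ E) ∧ ∀ i ∉ G, x i = 0}

/-- The rational-valued Schreier metric space of order `α`. -/
abbrev schreierSpaceRat (a : Ordinal.{0} → ℕ → Ordinal.{0}) (α : Ordinal.{0}) :
    Set C₀(ℕ, ℝ) :=
  familySpace (schreierFamily a α) (Set.range ((↑) : ℚ → ℝ))

/-!
Fix a dense sequence `x` of rational vectors of `c₀`, where `x j` vanishes beyond its first `j`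
coordinates, and a dense sequence of `M`. For every constant `K`, approximate `K`-bi-Lipschitz maps
from initial segments of `x` to the dense sequence of `M` form a countable tree. An infinite branch
of it converges to an embedding of `c₀` into `M`, and there is one as soon as the rank of the tree
is at least every countable ordinal.

The tree of the enumerations of subsets of members of `S_α` has rank at least `α`. Moving the
coordinates of `x 0, …, x (n - 1)` isometrically onto an enumerated set of length `n`, an embedding
of `S_α(ℚ)` with constant `K` carries this tree into the tree of approximate embeddings with the
same constant. There are countably many integers `K` and uncountably many `α`, so a single `K`
serves all `α`.

The remaining separable metric spaces embed into `c₀` by Aharoni's theorem. Its coordinates are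
bumps of height `2 ^ k` around sets of diameter comparable to `2 ^ k`, one family for every integer
scale `k`.
-/

open Filter Topology TopologicalSpace
open scoped NNReal Ordinal

section BiLipschitz

variable {X Y Z : Type*} [MetricSpace X] [MetricSpace Y] [MetricSpace Z]

theorem biLipschitzEmbeds_iff : BiLipschitzEmbeds X Y ↔
    ∃ (K L : ℝ≥0) (f : X → Y), LipschitzWith K f ∧ AntilipschitzWith L f := by
  constructor
  · rintro ⟨s, D, f, hs, hD, hf⟩
    refine ⟨⟨s * D, by positivity⟩, ⟨s⁻¹, by positivity⟩, f,
      .of_dist_le_mul fun x y => (hf x y).2, .of_le_mul_dist fun x y => ?_⟩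
    exact (le_inv_mul_iff₀ hs).2 (hf x y).1
  · rintro ⟨K, L, f, hK, hL⟩
    refine ⟨(L + 1)⁻¹, (L + 1) * (K + 1), f, by positivity,
      one_le_mul_of_one_le_of_one_le (by simp) (by simp), fun x y => ⟨?_, ?_⟩⟩
    · rw [inv_mul_le_iff₀ (by positivity)]
      exact (hL.le_mul_dist x y).trans (by gcongr; simp)
    · rw [inv_mul_cancel_left₀ (by positivity)]
      exact (hK.dist_le_mul x y).trans (by gcongr; simp)

theorem BiLipschitzEmbeds.exists_nat (h : BiLipschitzEmbeds X Y) :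
    ∃ (K : ℕ) (f : X → Y), LipschitzWith K f ∧ AntilipschitzWith K f := by
  obtain ⟨K, L, f, hK, hL⟩ := biLipschitzEmbeds_iff.1 h
  obtain ⟨n, hn⟩ := exists_nat_ge (max K L)
  refine ⟨n, f, hK.weaken ((le_max_left K L).trans hn), fun x y => (hL x y).trans ?_⟩
  gcongr
  exact (le_max_right K L).trans hn

theorem BiLipschitzEmbeds.trans (h : BiLipschitzEmbeds X Y) (h' : BiLipschitzEmbeds Y Z) :
    BiLipschitzEmbeds X Z := by
  obtain ⟨K, L, f, hK, hL⟩ := biLipschitzEmbeds_iff.1 h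
  obtain ⟨K', L', g, hK', hL'⟩ := biLipschitzEmbeds_iff.1 h'
  exact biLipschitzEmbeds_iff.2 ⟨K' * K, L * L', g ∘ f, hK'.comp hK, hL'.comp hL⟩

theorem BiLipschitzEmbeds.of_dense [CompleteSpace Y] {s : Set X} (hs : Dense s)
    (h : BiLipschitzEmbeds s Y) : BiLipschitzEmbeds X Y := by
  obtain ⟨K, L, f, hK, hL⟩ := biLipschitzEmbeds_iff.1 h
  have hcont : Continuous (hs.extend f) :=
    (hs.uniformContinuous_extend hK.uniformContinuous).continuous
  have hext : ∀ x : s, hs.extend f x = f x := hs.extend_of_ind hK.uniformContinuous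
  refine biLipschitzEmbeds_iff.2
    ⟨K, L, hs.extend f, .of_dist_le_mul fun x y => ?_, .of_le_mul_dist fun x y => ?_⟩
  · refine hs.denseRange_val.induction_on₂ (isClosed_le (by fun_prop) (by fun_prop))
      (fun x y => ?_) x y
    simpa only [hext, Subtype.dist_eq] using hK.dist_le_mul x y
  · refine hs.denseRange_val.induction_on₂ (isClosed_le (by fun_prop) (by fun_prop))
      (fun x y => ?_) x y
    simpa only [hext, Subtype.dist_eq] using hL.le_mul_dist x y

theorem biLipschitzEmbeds_of_denseRange [CompleteSpace Y] {ι : Type*} {x : ι → X}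
    (hx : DenseRange x) {g : ι → Y} {K L : ℝ≥0}
    (hg : ∀ i j, dist (g i) (g j) ≤ K * dist (x i) (x j))
    (hg' : ∀ i j, dist (x i) (x j) ≤ L * dist (g i) (g j)) : BiLipschitzEmbeds X Y := by
  refine .of_dense hx (biLipschitzEmbeds_iff.2 ⟨K, L, fun y => g (Set.rangeSplitting x y),
    .of_dist_le_mul fun y z => ?_, .of_le_mul_dist fun y z => ?_⟩)
  · simpa only [Set.apply_rangeSplitting, Subtype.dist_eq] using
      hg (Set.rangeSplitting x y) (Set.rangeSplitting x z)
  · simpa only [Set.apply_rangeSplitting, Subtype.dist_eq] using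
      hg' (Set.rangeSplitting x y) (Set.rangeSplitting x z)

end BiLipschitz

section ZeroAtInfty

theorem zeroAtInfty_dist_le_iff {α β : Type*} [TopologicalSpace α] [PseudoMetricSpace β] [Zero β]
    {f g : C₀(α, β)} {r : ℝ} (hr : 0 ≤ r) : dist f g ≤ r ↔ ∀ x, dist (f x) (g x) ≤ r := by
  rw [← ZeroAtInftyContinuousMap.dist_toBCF_eq_dist]
  exact BoundedContinuousFunction.dist_le hr

theorem dist_apply_le_zeroAtInfty_dist {α β : Type*} [TopologicalSpace α] [PseudoMetricSpace β]
    [Zero β] (f g : C₀(α, β)) (x : α) : dist (f x) (g x) ≤ dist f g :=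
  (zeroAtInfty_dist_le_iff dist_nonneg).1 le_rfl x

theorem zeroAtInfty_tendsto_cofinite {α β : Type*} [TopologicalSpace α] [DiscreteTopology α]
    [TopologicalSpace β] [Zero β] (z : C₀(α, β)) : Tendsto z cofinite (𝓝 0) := by
  rw [← cocompact_eq_cofinite]
  exact z.zero_at_infty'

/-- The element of `c₀` with the coordinates `v`. -/
def c0OfTendsto (v : ℕ → ℝ) (hv : Tendsto v cofinite (𝓝 0)) : C₀(ℕ, ℝ) where
  toFun := v
  continuous_toFun := continuous_of_discreteTopology
  zero_at_infty' := by rwa [cocompact_eq_cofinite]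

@[simp]
theorem c0OfTendsto_apply (v : ℕ → ℝ) (hv : Tendsto v cofinite (𝓝 0)) (i : ℕ) :
    c0OfTendsto v hv i = v i := rfl

theorem tendsto_cofinite_zero_of_finset {ι β : Type*} [TopologicalSpace β] [Zero β] {v : ι → β}
    (s : Finset ι) (hv : ∀ i ∉ s, v i = 0) : Tendsto v cofinite (𝓝 0) := by
  refine tendsto_const_nhds.congr' ?_
  filter_upwards [s.finite_toSet.compl_mem_cofinite] with i hi
  exact (hv i hi).symm

end ZeroAtInfty

section Aharoni

variable {X : Type*} [MetricSpace X]

theorem biLipschitzEmbeds_c0_of_separating {ι : Type*} [Denumerable ι] {f : ι → X → ℝ} {K L : ℝ≥0}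
    (hlip : ∀ i, LipschitzWith K (f i)) (hzero : ∀ x, Tendsto (fun i => f i x) cofinite (𝓝 0))
    (hsep : ∀ x y, x ≠ y → ∃ i, dist x y ≤ L * dist (f i x) (f i y)) :
    BiLipschitzEmbeds X C₀(ℕ, ℝ) := by
  let e : ℕ ≃ ι := (Denumerable.eqv ι).symm
  let F : X → C₀(ℕ, ℝ) := fun x =>
    c0OfTendsto (fun n => f (e n) x) ((hzero x).comp e.injective.tendsto_cofinite)
  refine biLipschitzEmbeds_iff.2
    ⟨K, L, F, .of_dist_le_mul fun x y => ?_, .of_le_mul_dist fun x y => ?_⟩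
  · exact (zeroAtInfty_dist_le_iff (by positivity)).2 fun n => (hlip (e n)).dist_le_mul x y
  · rcases eq_or_ne x y with rfl | hxy
    · simp
    obtain ⟨i, hi⟩ := hsep x y hxy
    have hcoord : dist (f i x) (f i y) ≤ dist (F x) (F y) := by
      simpa [F] using dist_apply_le_zeroAtInfty_dist (F x) (F y) (e.symm i)
    exact hi.trans (by gcongr)

/-- The `i`-th cell of the partition of `{x | 2 * τ ≤ dist x o}` according to the first term of the
sequence `u` at distance less than `2 * τ`. -/
def aharoniCell (u : ℕ → X) (o : X) (τ : ℝ) (i : ℕ) : Set X :=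
  {x | dist x (u i) < 2 * τ ∧ (∀ j < i, 2 * τ ≤ dist x (u j)) ∧ 2 * τ ≤ dist x o}

/-- The functions of scale `τ` in Aharoni's embedding: the bump of height `τ` and slope `1` around
the `i`-th cell. -/
noncomputable def aharoniBump (u : ℕ → X) (o : X) {τ : ℝ} (hτ : 0 < τ) (i : ℕ) (x : X) : ℝ :=
  τ * thickenedIndicator hτ (aharoniCell u o τ i) x

variable {u : ℕ → X} {o x y : X} {τ : ℝ} {i : ℕ}

theorem exists_mem_aharoniCell (hu : DenseRange u) (hτ : 0 < τ) (hxo : 2 * τ ≤ dist x o) :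
    ∃ i, x ∈ aharoniCell u o τ i := by
  classical
  have hex : ∃ i, dist x (u i) < 2 * τ := hu.exists_dist_lt x (by positivity)
  exact ⟨Nat.find hex, Nat.find_spec hex, fun j hj => not_lt.1 (Nat.find_min hex hj), hxo⟩

theorem lipschitzWith_aharoniBump (u : ℕ → X) (o : X) (hτ : 0 < τ) (i : ℕ) :
    LipschitzWith 1 (aharoniBump u o hτ i) := by
  refine .of_dist_le_mul fun x y => ?_
  have h := (lipschitzWith_thickenedIndicator hτ (aharoniCell u o τ i)).dist_le_mul x y
  rw [NNReal.coe_inv, Real.coe_toNNReal τ hτ.le, NNReal.dist_eq, le_inv_mul_iff₀ hτ] at h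
  rwa [aharoniBump, aharoniBump, Real.dist_eq, ← mul_sub, abs_mul, abs_of_pos hτ, NNReal.coe_one,
    one_mul]

theorem aharoniBump_nonneg (hτ : 0 < τ) : 0 ≤ aharoniBump u o hτ i x :=
  mul_nonneg hτ.le (NNReal.coe_nonneg _)

theorem aharoniBump_le (hτ : 0 < τ) : aharoniBump u o hτ i x ≤ τ :=
  mul_le_of_le_one_right hτ.le (mod_cast thickenedIndicator_le_one hτ _ x)

theorem aharoniBump_of_mem (hτ : 0 < τ) (hx : x ∈ aharoniCell u o τ i) :
    aharoniBump u o hτ i x = τ := by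
  rw [aharoniBump, thickenedIndicator_one hτ _ hx, NNReal.coe_one, mul_one]

theorem exists_mem_aharoniCell_of_aharoniBump_ne_zero (hτ : 0 < τ)
    (hx : aharoniBump u o hτ i x ≠ 0) : ∃ b ∈ aharoniCell u o τ i, dist x b < τ := by
  rw [← Metric.mem_thickening_iff]
  contrapose! hx
  rw [aharoniBump, thickenedIndicator_zero hτ _ hx, NNReal.coe_zero, mul_zero]

theorem lt_dist_of_aharoniBump_ne_zero (hτ : 0 < τ) (hx : aharoniBump u o hτ i x ≠ 0) :
    τ < dist x o := by
  obtain ⟨b, ⟨-, -, hbo⟩, hxb⟩ := exists_mem_aharoniCell_of_aharoniBump_ne_zero hτ hx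
  linarith [dist_triangle_left b o x]

theorem finite_aharoniBump_ne_zero (hu : DenseRange u) (o x : X) (hτ : 0 < τ) :
    {i | aharoniBump u o hτ i x ≠ 0}.Finite := by
  obtain ⟨j, hj⟩ := hu.exists_dist_lt x hτ
  refine (Set.finite_Iic j).subset fun i hi => Set.mem_Iic.2 (not_lt.1 fun hji => ?_)
  obtain ⟨b, ⟨-, hfirst, -⟩, hxb⟩ := exists_mem_aharoniCell_of_aharoniBump_ne_zero hτ hi
  linarith [hfirst j hji, dist_triangle_left b (u j) x]

theorem aharoniBump_eq_zero_of_le_dist (hτ : 0 < τ) (hx : x ∈ aharoniCell u o τ i)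
    (hxy : 5 * τ ≤ dist x y) : aharoniBump u o hτ i y = 0 := by
  by_contra hy
  obtain ⟨b, ⟨hbu, -, -⟩, hyb⟩ := exists_mem_aharoniCell_of_aharoniBump_ne_zero hτ hy
  linarith [hx.1, dist_triangle_right x b (u i), dist_triangle_right x y b]

theorem exists_dist_aharoniBump_eq (hu : DenseRange u) (o : X) (hτ : 0 < τ)
    (hxy : 5 * τ ≤ dist x y) : ∃ i, dist (aharoniBump u o hτ i x) (aharoniBump u o hτ i y) = τ := by
  wlog hxo : 2 * τ ≤ dist x o generalizing x y
  · obtain ⟨i, hi⟩ := this (x := y) (y := x) (by rwa [dist_comm])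
      (by linarith [dist_triangle_right x y o])
    exact ⟨i, by rwa [dist_comm]⟩
  obtain ⟨i, hi⟩ := exists_mem_aharoniCell hu hτ hxo
  refine ⟨i, ?_⟩
  rw [aharoniBump_of_mem hτ hi, aharoniBump_eq_zero_of_le_dist hτ hi hxy, Real.dist_0_eq_abs,
    abs_of_pos hτ]

-- Bumps of small scale are small, and bumps of large scale vanish near the base point.
theorem tendsto_aharoniBump_cofinite (hu : DenseRange u) (o x : X) :
    Tendsto (fun p : ℤ × ℕ => aharoniBump u o (zpow_pos two_pos p.1) p.2 x) cofinite (𝓝 0) := by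
  refine Metric.tendsto_nhds.2 fun ε hε => ?_
  obtain ⟨k₀, hk₀, -⟩ := exists_mem_Ioc_zpow hε one_lt_two
  obtain ⟨k₁, hk₁⟩ := pow_unbounded_of_one_lt (dist x o) one_lt_two
  refine Set.Finite.subset (((Set.finite_Icc k₀ (k₁ : ℤ)).biUnion fun k _ =>
    (finite_aharoniBump_ne_zero hu o x (zpow_pos two_pos k)).image (Prod.mk k))) ?_
  rintro ⟨k, i⟩ hki
  have hεle : ε ≤ aharoniBump u o (zpow_pos two_pos k) i x := by
    simpa [abs_of_nonneg (aharoniBump_nonneg (zpow_pos two_pos k))] using hki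
  have hne : aharoniBump u o (zpow_pos two_pos k) i x ≠ 0 := (hε.trans_le hεle).ne'
  have hlow : (2 : ℝ) ^ k₀ < 2 ^ k := hk₀.trans_le (hεle.trans (aharoniBump_le _))
  have hupp : (2 : ℝ) ^ k < 2 ^ (k₁ : ℤ) := by
    rw [zpow_natCast]
    exact (lt_dist_of_aharoniBump_ne_zero _ hne).trans hk₁
  rw [zpow_lt_zpow_iff_right₀ one_lt_two] at hlow hupp
  exact Set.mem_biUnion ⟨hlow.le, hupp.le⟩ ⟨i, hne, rfl⟩

/-- Aharoni's theorem. -/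
theorem biLipschitzEmbeds_c0 (X : Type*) [MetricSpace X] [SeparableSpace X] :
    BiLipschitzEmbeds X C₀(ℕ, ℝ) := by
  rcases isEmpty_or_nonempty X with hX | ⟨⟨o⟩⟩
  · exact ⟨1, 1, fun _ => 0, one_pos, le_rfl, fun x => isEmptyElim x⟩
  have : Nonempty X := ⟨o⟩
  have hu := denseRange_denseSeq X
  refine biLipschitzEmbeds_c0_of_separating (L := 10)
    (fun p : ℤ × ℕ => lipschitzWith_aharoniBump (denseSeq X) o (zpow_pos two_pos p.1) p.2)
    (tendsto_aharoniBump_cofinite hu o) fun x y hxy => ?_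
  have hpos : 0 < dist x y / 5 := by linarith [dist_pos.2 hxy]
  obtain ⟨k, hk, hk'⟩ := exists_mem_Ico_zpow hpos one_lt_two
  rw [zpow_add_one₀ two_ne_zero] at hk'
  obtain ⟨i, hi⟩ := exists_dist_aharoniBump_eq hu o (zpow_pos two_pos k) (by linarith)
  refine ⟨(k, i), ?_⟩
  rw [hi, NNReal.coe_ofNat]
  linarith

end Aharoni

section Rank

/-- The rank of `t` with respect to the relation `r`, whose descending chains are thought of as
branches starting at `t`, is at least `α`. No well-foundedness is assumed: a point from which an
infinite descending chain starts has rank at least `α` for all `α`. -/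
def HasRankGE {T : Type*} (r : T → T → Prop) (α : Ordinal) (t : T) : Prop :=
  ∀ β < α, ∃ s, r s t ∧ HasRankGE r β s
termination_by α

variable {S T : Type*} {r : T → T → Prop} {t : T} {α β : Ordinal}

theorem hasRankGE_iff : HasRankGE r α t ↔ ∀ β < α, ∃ s, r s t ∧ HasRankGE r β s := by
  rw [HasRankGE]

theorem HasRankGE.anti (h : HasRankGE r β t) (hαβ : α ≤ β) : HasRankGE r α t :=
  hasRankGE_iff.2 fun γ hγ => hasRankGE_iff.1 h γ (hγ.trans_le hαβ)

theorem hasRankGE_zero : HasRankGE r 0 t :=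
  hasRankGE_iff.2 fun _ hβ => absurd hβ not_lt_zero

theorem hasRankGE_succ_iff : HasRankGE r (Order.succ α) t ↔ ∃ s, r s t ∧ HasRankGE r α s := by
  refine hasRankGE_iff.trans ⟨fun h => h α (Order.lt_succ α), ?_⟩
  rintro ⟨s, hst, hs⟩ β hβ
  exact ⟨s, hst, hs.anti (Order.lt_succ_iff.1 hβ)⟩

theorem hasRankGE_of_forall_lt (h : ∀ γ < α, ∃ β, γ < β ∧ HasRankGE r β t) : HasRankGE r α t := by
  refine hasRankGE_iff.2 fun γ hγ => ?_
  obtain ⟨β, hγβ, hβ⟩ := h γ hγ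
  exact hasRankGE_iff.1 hβ γ hγβ

theorem HasRankGE.map {q : S → S → Prop} (f : T → S) (hf : ∀ s t, r s t → q (f s) (f t))
    (h : HasRankGE r α t) : HasRankGE q α (f t) := by
  induction α using WellFoundedLT.induction generalizing t with
  | ind α ih =>
    refine hasRankGE_iff.2 fun β hβ => ?_
    obtain ⟨s, hst, hs⟩ := hasRankGE_iff.1 h β hβ
    exact ⟨f s, hf s t hst, ih β hβ hs⟩

theorem exists_forall_lt_omega_one_of_anti {ι : Type*} [Countable ι] {P : ι → Ordinal → Prop}
    (hP : ∀ i, Antitone (P i)) (h : ∀ α < ω₁, ∃ i, P i α) :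
    ∃ i, ∀ α < ω₁, P i α := by
  by_contra! hno
  choose bad hbad hPbad using hno
  obtain ⟨i, hi⟩ := h (⨆ i, bad i) (Ordinal.iSup_lt_omega_one hbad)
  exact hPbad i (hP i (Ordinal.le_iSup bad i) hi)

theorem exists_descending_chain_of_hasRankGE [Countable T] (ht : ∀ α < ω₁, HasRankGE r α t) :
    ∃ p : ℕ → T, p 0 = t ∧ ∀ n, r (p (n + 1)) (p n) := by
  have hchild : ∀ u : {u // ∀ α < ω₁, HasRankGE r α u},
      ∃ s : {s // ∀ α < ω₁, HasRankGE r α s}, r s u := by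
    rintro ⟨u, hu⟩
    obtain ⟨s, hs⟩ := exists_forall_lt_omega_one_of_anti (P := fun s α => r s u ∧ HasRankGE r α s)
      (fun s α β hαβ h => ⟨h.1, h.2.anti hαβ⟩) fun α hα =>
        hasRankGE_succ_iff.1 (hu _ ((Cardinal.isSuccLimit_omega 1).succ_lt hα))
    exact ⟨⟨s, fun α hα => (hs α hα).2⟩, (hs 0 (Ordinal.omega_pos 1)).1⟩
  choose next hnext using hchild
  refine ⟨fun n => next^[n] ⟨t, ht⟩, rfl, fun n => ?_⟩
  simp only [Function.iterate_succ_apply']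
  exact hnext _

end Rank

section SetFamilies

/-- The extension relation of the tree of the repetition-free enumerations of subsets of members of
`𝓖`. The rank of its root `[]` is the rank of `𝓖`. -/
def FamilyExtends (𝓖 : Set (Finset ℕ)) (l' l : List ℕ) : Prop :=
  ∃ m, l' = l ++ [m] ∧ l'.Nodup ∧ ∃ G ∈ 𝓖, ∀ p ∈ l', p ∈ G

variable {𝓖 𝓗 : Set (Finset ℕ)} {α : Ordinal}

theorem FamilyExtends.mono (h𝓖 : 𝓖 ⊆ 𝓗) {l' l : List ℕ} (h : FamilyExtends 𝓖 l' l) :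
    FamilyExtends 𝓗 l' l := by
  obtain ⟨m, hl', hnodup, G, hG, hsub⟩ := h
  exact ⟨m, hl', hnodup, G, h𝓖 hG, hsub⟩

theorem FamilyExtends.cons {n : ℕ} (hn : ∀ G ∈ 𝓖, n ∉ G ∧ insert n G ∈ 𝓗) {l' l : List ℕ}
    (h : FamilyExtends 𝓖 l' l) : FamilyExtends 𝓗 (n :: l') (n :: l) := by
  obtain ⟨m, rfl, hnodup, G, hG, hsub⟩ := h
  refine ⟨m, rfl, List.nodup_cons.2 ⟨fun hmem => (hn G hG).1 (hsub n hmem), hnodup⟩,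
    insert n G, (hn G hG).2, fun p hp => ?_⟩
  exact Finset.mem_insert.2 ((List.mem_cons.1 hp).imp_right (hsub p))

theorem hasRankGE_familyExtends_mono (h𝓖 : 𝓖 ⊆ 𝓗) (h : HasRankGE (FamilyExtends 𝓖) α []) :
    HasRankGE (FamilyExtends 𝓗) α [] :=
  h.map id fun _ _ => FamilyExtends.mono h𝓖

theorem hasRankGE_familyExtends_succ {n : ℕ} (hn : ∀ G ∈ 𝓖, n ∉ G ∧ insert n G ∈ 𝓗)
    (hn' : {n} ∈ 𝓗) (h : HasRankGE (FamilyExtends 𝓖) α []) :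
    HasRankGE (FamilyExtends 𝓗) (Order.succ α) [] :=
  hasRankGE_succ_iff.2 ⟨[n], ⟨n, rfl, List.nodup_singleton n, {n}, hn', by simp⟩,
    h.map (n :: ·) fun _ _ => FamilyExtends.cons hn⟩

end SetFamilies

section Schreier

variable {a : Ordinal.{0} → ℕ → Ordinal.{0}} {α : Ordinal.{0}}

theorem schreierMem_singleton (ha : IsLadderSystem a) (hα : α < ω₁) {m : ℕ} (hm : 1 ≤ m) :
    SchreierMem a α {m} := by
  induction α using Ordinal.limitRecOn with
  | zero => exact .zero m hm
  | add_one α ih =>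
    rw [← Order.succ_eq_add_one] at hα ⊢
    have h := SchreierMem.succ α 1 le_rfl (fun _ => {m}) (fun _ => ih ((Order.lt_succ α).trans hα))
      (by simpa using hm) (fun i j hij => by omega)
    simpa using h
  | limit α hlim ih =>
    have hlt := (ha α hα hlim).2.1 1
    exact .limit α hlim 1 le_rfl {m} (by simpa using hm) (ih _ hlt (hlt.trans hα))

theorem SchreierMem.insert (ha : IsLadderSystem a) (hα : α < ω₁) {m : ℕ} (hm : 2 ≤ m)
    {G : Finset ℕ} (hG : SchreierMem a α G) (hmG : ∀ x ∈ G, m < x) :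
    SchreierMem a (Order.succ α) (insert m G) := by
  have hsingleton := schreierMem_singleton ha hα (one_le_two.trans hm)
  have h : SchreierMem a (Order.succ α) (Finset.univ.biUnion ![{m}, G]) := by
    refine .succ α 2 one_le_two _ ?_ ?_ ?_ <;> simp only [Fin.forall_fin_two]
    · exact ⟨hsingleton, hG⟩
    · exact ⟨by simpa using hm, fun x hx => hm.trans (hmG x hx).le⟩
    · simpa using hmG
  convert h using 1
  ext x
  simp [Fin.exists_fin_two]

theorem hasRankGE_schreierFamily_ge (ha : IsLadderSystem a) (hα : α < ω₁) (N : ℕ) :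
    HasRankGE (FamilyExtends {G ∈ schreierFamily a α | ∀ x ∈ G, N ≤ x}) α [] := by
  induction α using Ordinal.limitRecOn generalizing N with
  | zero => exact hasRankGE_zero
  | add_one α ih =>
    rw [← Order.succ_eq_add_one] at hα ⊢
    have hα' := (Order.lt_succ α).trans hα
    let n := max N 2
    have hnN : N ≤ n := le_max_left N 2
    have hn2 : 2 ≤ n := le_max_right N 2
    refine hasRankGE_familyExtends_succ (n := n) ?_ ?_ (ih hα' (n + 1))
    · rintro G ⟨hG, hnG⟩
      refine ⟨fun hn => (hnG n hn).not_gt n.lt_succ_self, hG.insert ha hα' hn2 hnG, fun x hx => ?_⟩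
      rcases Finset.mem_insert.1 hx with rfl | hx
      · exact hnN
      · exact hnN.trans (Nat.le_of_succ_le (hnG x hx))
    · exact ⟨schreierMem_singleton ha hα (one_le_two.trans hn2), by simpa using hnN⟩
  | limit α hlim ih =>
    obtain ⟨hmono, hlt, hsup⟩ := ha α hα hlim
    refine hasRankGE_of_forall_lt fun γ hγ => ?_
    obtain ⟨n, hn⟩ := hsup γ hγ
    -- The term of index `0` of a ladder is not used by the Schreier families.
    refine ⟨a α (n + 1), hn.trans_le (hmono n.le_succ), hasRankGE_familyExtends_mono ?_
      (ih _ (hlt _) ((hlt _).trans hα) (max N (n + 1)))⟩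
    rintro G ⟨hG, hNG⟩
    exact ⟨.limit α hlim (n + 1) n.succ_pos G (fun x hx => (le_max_right _ _).trans (hNG x hx)) hG,
      fun x hx => (le_max_left _ _).trans (hNG x hx)⟩

theorem hasRankGE_schreierFamily (ha : IsLadderSystem a) (hα : α < ω₁) :
    HasRankGE (FamilyExtends (schreierFamily a α)) α [] :=
  hasRankGE_familyExtends_mono (Set.sep_subset _ _) (hasRankGE_schreierFamily_ge ha hα 0)

end Schreier

section RationalVectors

theorem exists_surjective_nat_forall_le {T : Type*} [Countable T] (b : T → ℕ) {t₀ : T}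
    (ht₀ : b t₀ = 0) : ∃ e : ℕ → T, Function.Surjective e ∧ ∀ n, b (e n) ≤ n := by
  have : Nonempty T := ⟨t₀⟩
  obtain ⟨f, hf⟩ := exists_surjective_nat T
  refine ⟨fun n => if b (f n.unpair.1) ≤ n then f n.unpair.1 else t₀, fun t => ?_, fun n => ?_⟩
  · obtain ⟨k, rfl⟩ := hf t
    exact ⟨Nat.pair k (b (f k)), by simp [Nat.right_le_pair]⟩
  · dsimp only
    split_ifs with h
    · exact h
    · simp [ht₀]

/-- The finitely supported rational vectors, as elements of `c₀`. -/
def ratVector (v : ℕ →₀ ℚ) : C₀(ℕ, ℝ) :=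
  c0OfTendsto (fun i => v i)
    (tendsto_cofinite_zero_of_finset v.support fun i hi => by simpa using hi)

theorem denseRange_ratVector : DenseRange ratVector := by
  refine Metric.dense_iff.2 fun z ε hε => ?_
  have hfin : {i | ¬ dist (z i) 0 < ε / 2}.Finite :=
    Metric.tendsto_nhds.1 (zeroAtInfty_tendsto_cofinite z) (ε / 2) (by positivity)
  choose q hq using fun i => Rat.isDenseEmbedding_coe_real.dense.exists_dist_lt (z i) (half_pos hε)
  let v : ℕ →₀ ℚ := Finsupp.indicator hfin.toFinset fun i _ => q i
  refine ⟨ratVector v, ?_, v, rfl⟩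
  rw [Metric.mem_ball']
  refine ((zeroAtInfty_dist_le_iff (half_pos hε).le).2 fun i => ?_).trans_lt (half_lt_self hε)
  by_cases hi : i ∈ hfin.toFinset
  · have hv : v i = q i := Finsupp.indicator_of_mem hi _
    simpa [ratVector, hv] using (hq i).le
  · have hsmall : dist (z i) 0 < ε / 2 := by simpa using hi
    have hv : v i = 0 := Finsupp.indicator_of_notMem hi _
    simpa [ratVector, hv] using hsmall.le

theorem exists_denseRange_rat_of_vanishing : ∃ x : ℕ → C₀(ℕ, ℝ), DenseRange x ∧
    (∀ j i, x j i ∈ Set.range ((↑) : ℚ → ℝ)) ∧ ∀ j i, j ≤ i → x j i = 0 := by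
  obtain ⟨e, he, hbound⟩ := exists_surjective_nat_forall_le
    (fun v : ℕ →₀ ℚ => v.support.sup Nat.succ) (t₀ := 0) (by simp)
  have hdense : DenseRange (ratVector ∘ e) := by
    rw [DenseRange, he.range_comp]
    exact denseRange_ratVector
  refine ⟨ratVector ∘ e, hdense, fun j i => ⟨e j i, rfl⟩, fun j i hji => ?_⟩
  have hi : i ∉ (e j).support := fun hi =>
    (Finset.le_sup (f := Nat.succ) hi).not_gt ((hbound j).trans_lt (Nat.lt_succ_of_le hji))
  simpa [ratVector] using hi

end RationalVectors

section Transplant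

/-- The vector obtained from `z` by moving its `i`-th coordinate to the `i`-th entry of `l`, and
forgetting the coordinates of index at least `l.length`. -/
def transplant (l : List ℕ) (z : C₀(ℕ, ℝ)) : C₀(ℕ, ℝ) :=
  c0OfTendsto (fun p => if p ∈ l then z (l.idxOf p) else 0)
    (tendsto_cofinite_zero_of_finset l.toFinset fun _ hp =>
      if_neg fun h => hp (List.mem_toFinset.2 h))

variable {l : List ℕ} {z z' : C₀(ℕ, ℝ)}

theorem transplant_apply_of_mem {p : ℕ} (hp : p ∈ l) : transplant l z p = z (l.idxOf p) :=
  if_pos hp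

theorem transplant_apply_of_notMem {p : ℕ} (hp : p ∉ l) : transplant l z p = 0 :=
  if_neg hp

theorem transplant_mem_familySpace {𝓖 : Set (Finset ℕ)} {E : Set ℝ} (hE : 0 ∈ E)
    (hz : ∀ i, z i ∈ E) {G : Finset ℕ} (hG : G ∈ 𝓖) (hl : ∀ p ∈ l, p ∈ G) :
    transplant l z ∈ familySpace 𝓖 E := by
  refine ⟨G, hG, fun p _ => ?_, fun p hp => transplant_apply_of_notMem fun h => hp (hl p h)⟩
  by_cases hp : p ∈ l
  · simpa only [transplant_apply_of_mem hp] using hz _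
  · simpa only [transplant_apply_of_notMem hp] using hE

theorem transplant_append_singleton (hz : ∀ i, l.length ≤ i → z i = 0) (m : ℕ) :
    transplant (l ++ [m]) z = transplant l z := by
  ext p
  by_cases hp : p ∈ l
  · rw [transplant_apply_of_mem hp, transplant_apply_of_mem (List.mem_append_left _ hp),
      List.idxOf_append_of_mem hp]
  · rw [transplant_apply_of_notMem hp]
    by_cases hp' : p ∈ l ++ [m]
    · rw [transplant_apply_of_mem hp', List.idxOf_append_of_notMem hp]
      exact hz _ (Nat.le_add_right _ _)
    · exact transplant_apply_of_notMem hp'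

theorem dist_transplant_le (l : List ℕ) (z z' : C₀(ℕ, ℝ)) :
    dist (transplant l z) (transplant l z') ≤ dist z z' := by
  refine (zeroAtInfty_dist_le_iff dist_nonneg).2 fun p => ?_
  by_cases hp : p ∈ l
  · simpa only [transplant_apply_of_mem hp] using dist_apply_le_zeroAtInfty_dist z z' _
  · simp only [transplant_apply_of_notMem hp, dist_self, dist_nonneg]

theorem dist_transplant (hl : l.Nodup) (hz : ∀ i, l.length ≤ i → z i = 0)
    (hz' : ∀ i, l.length ≤ i → z' i = 0) :
    dist (transplant l z) (transplant l z') = dist z z' := by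
  refine (dist_transplant_le l z z').antisymm ((zeroAtInfty_dist_le_iff dist_nonneg).2 fun i => ?_)
  rcases lt_or_ge i l.length with hi | hi
  · simpa only [transplant_apply_of_mem (List.getElem_mem hi), hl.idxOf_getElem] using
      dist_apply_le_zeroAtInfty_dist (transplant l z) (transplant l z') l[i]
  · simp only [hz i hi, hz' i hi, dist_self, dist_nonneg]

end Transplant

section PartialEmbeddings

variable {X M : Type*} [MetricSpace X] [MetricSpace M]

/-- On the first `n` terms of the sequence `x`, the map `x j ↦ y j` is bi-Lipschitz with constant
`K` up to the additive error `ε` in the distances of the target. -/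
def AlmostBiLipschitz (K : ℝ≥0) (ε : ℝ) (n : ℕ) (x : ℕ → X) (y : ℕ → M) : Prop :=
  ∀ i < n, ∀ j < n, dist (y i) (y j) ≤ K * dist (x i) (x j) + ε ∧
    dist (x i) (x j) ≤ K * (dist (y i) (y j) + ε)

theorem AlmostBiLipschitz.of_dist_le {K : ℝ≥0} {δ : ℝ} {n : ℕ} {x : ℕ → X} {y y' : ℕ → M}
    (h : AlmostBiLipschitz K 0 n x y) (hy : ∀ j < n, dist (y j) (y' j) ≤ δ) :
    AlmostBiLipschitz K (2 * δ) n x y' := by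
  intro i hi j hj
  obtain ⟨hupper, hlower⟩ := h i hi j hj
  rw [add_zero] at hupper hlower
  refine ⟨?_, hlower.trans ?_⟩
  · linarith [dist_triangle4_left (y i) (y j) (y' i) (y' j), hy i hi, hy j hj]
  · gcongr
    linarith [dist_triangle4_right (y i) (y j) (y' i) (y' j), hy i hi, hy j hj]

theorem biLipschitz_of_tendsto_almostBiLipschitz {K : ℝ≥0} {ε : ℕ → ℝ} {x : ℕ → X}
    {y : ℕ → ℕ → M} {g : ℕ → M} (hε : Tendsto ε atTop (𝓝 0))
    (hy : ∀ j, Tendsto (fun n => y n j) atTop (𝓝 (g j)))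
    (h : ∀ n, AlmostBiLipschitz K (ε n) n x (y n)) (i j : ℕ) :
    dist (g i) (g j) ≤ K * dist (x i) (x j) ∧ dist (x i) (x j) ≤ K * dist (g i) (g j) := by
  have hdist : Tendsto (fun n => dist (y n i) (y n j)) atTop (𝓝 (dist (g i) (g j))) :=
    (hy i).dist (hy j)
  have hev : ∀ᶠ n in atTop, i < n ∧ j < n := (eventually_gt_atTop i).and (eventually_gt_atTop j)
  constructor
  · refine le_of_tendsto_of_tendsto hdist (by simpa using hε.const_add (K * dist (x i) (x j))) ?_
    filter_upwards [hev] with n hn using (h n i hn.1 j hn.2).1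
  · refine ge_of_tendsto (by simpa using (hdist.add hε).const_mul (K : ℝ)) ?_
    filter_upwards [hev] with n hn using (h n i hn.1 j hn.2).2

/-- The sequence `j ↦ d (p j)`, extended by `d 0` beyond the length of `p`. -/
def decode (d : ℕ → M) (p : List ℕ) (j : ℕ) : M :=
  d (p.getD j 0)

theorem exists_decode_dist_le {d : ℕ → M} (hd : DenseRange d) (y : ℕ → M) (n : ℕ) {δ : ℝ}
    (hδ : 0 < δ) : ∃ p : List ℕ, p.length = n ∧ ∀ j < n, dist (y j) (decode d p j) ≤ δ := by
  choose k hk using fun j => hd.exists_dist_lt (y j) hδ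
  refine ⟨(List.range n).map k, by simp, fun j hj => ?_⟩
  have hdecode : decode d ((List.range n).map k) j = d (k j) := by
    simp [decode, List.getD_eq_getElem?_getD, hj]
  exact hdecode ▸ (hk j).le

/-- The extension relation of the tree of approximate partial embeddings of `X` into `M`. A list `p`
codes the map `x j ↦ d (p j)` on the first `p.length` terms of the sequence `x`. An extension codes
one more value, but may move the previous ones by a geometrically decreasing amount, so that an
infinite branch only has to converge to an embedding. -/
structure Refines (x : ℕ → X) (d : ℕ → M) (K : ℝ≥0) (q p : List ℕ) : Prop where
  length_eq : q.length = p.length + 1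
  dist_le : ∀ j < p.length, dist (decode d p j) (decode d q j) ≤ 2 * (1 / 2) ^ p.length
  almostBiLipschitz : AlmostBiLipschitz K (2 * (1 / 2) ^ q.length) q.length x (decode d q)

variable {x : ℕ → X} {d : ℕ → M} {K : ℝ≥0}

theorem refines_of_dist_le {p q : List ℕ} {y y' : ℕ → M} (hlen : q.length = p.length + 1)
    (hyy' : ∀ j < p.length, y j = y' j)
    (hp : ∀ j < p.length, dist (y j) (decode d p j) ≤ (1 / 2) ^ p.length)
    (hq : ∀ j < q.length, dist (y' j) (decode d q j) ≤ (1 / 2) ^ q.length)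
    (hy' : AlmostBiLipschitz K 0 q.length x y') : Refines x d K q p where
  length_eq := hlen
  dist_le j hj := by
    have hqj := hq j (by omega)
    rw [hlen, pow_succ, ← hyy' j hj] at hqj
    have hpos : (0 : ℝ) < (1 / 2) ^ p.length := by positivity
    linarith [hp j hj, dist_triangle_left (decode d p j) (decode d q j) (y j)]
  almostBiLipschitz := hy'.of_dist_le hq

theorem length_of_refines_chain {p : ℕ → List ℕ} (hp₀ : p 0 = [])
    (hp : ∀ n, Refines x d K (p (n + 1)) (p n)) (n : ℕ) : (p n).length = n := by
  induction n with
  | zero => rw [hp₀, List.length_nil]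
  | succ n ih => rw [(hp n).length_eq, ih]

theorem exists_tendsto_decode_of_refines_chain [CompleteSpace M] {p : ℕ → List ℕ} (hp₀ : p 0 = [])
    (hp : ∀ n, Refines x d K (p (n + 1)) (p n)) (j : ℕ) :
    ∃ y, Tendsto (fun n => decode d (p n) j) atTop (𝓝 y) := by
  have hlen := length_of_refines_chain hp₀ hp
  have hcauchy : CauchySeq fun n => decode d (p (n + (j + 1))) j := by
    refine cauchySeq_of_le_geometric (1 / 2) 2 (by norm_num) fun n => ?_
    rw [Nat.add_right_comm n 1]
    refine ((hp _).dist_le j (by rw [hlen]; omega)).trans ?_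
    rw [hlen]
    gcongr 2 * ?_
    exact pow_le_pow_of_le_one (by norm_num) (by norm_num) (Nat.le_add_right _ _)
  obtain ⟨y, hy⟩ := cauchySeq_tendsto_of_complete hcauchy
  exact ⟨y, (tendsto_add_atTop_iff_nat (j + 1)).1 hy⟩

theorem biLipschitzEmbeds_of_refines_chain [CompleteSpace M] (hx : DenseRange x)
    {p : ℕ → List ℕ} (hp₀ : p 0 = []) (hp : ∀ n, Refines x d K (p (n + 1)) (p n)) :
    BiLipschitzEmbeds X M := by
  have hlen := length_of_refines_chain hp₀ hp
  choose g hg using exists_tendsto_decode_of_refines_chain hp₀ hp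
  have herr : Tendsto (fun n : ℕ => 2 * (1 / 2 : ℝ) ^ (n + 1)) atTop (𝓝 0) := by
    have hpow : Tendsto (fun n : ℕ => (1 / 2 : ℝ) ^ n) atTop (𝓝 0) :=
      tendsto_pow_atTop_nhds_zero_of_lt_one (by norm_num) (by norm_num)
    simpa using ((tendsto_add_atTop_iff_nat 1).2 hpow).const_mul 2
  have hlim := biLipschitz_of_tendsto_almostBiLipschitz (K := K) (x := x) herr
    (fun j => (tendsto_add_atTop_iff_nat 1).2 (hg j)) fun n i hi j hj => by
      have h := (hp n).almostBiLipschitz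
      rw [hlen] at h
      exact h i (hi.trans n.lt_succ_self) j (hj.trans n.lt_succ_self)
  exact biLipschitzEmbeds_of_denseRange hx (fun i j => (hlim i j).1) fun i j => (hlim i j).2

end PartialEmbeddings

section Universality

variable {M : Type*} [MetricSpace M] {𝓖 : Set (Finset ℕ)} {E : Set ℝ} {α : Ordinal} {K : ℝ≥0}

theorem almostBiLipschitz_transplant (hE : 0 ∈ E) {x : ℕ → C₀(ℕ, ℝ)} (hxE : ∀ j i, x j i ∈ E)
    (hx₀ : ∀ j i, j ≤ i → x j i = 0) {F : C₀(ℕ, ℝ) → M}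
    (hF : ∀ z ∈ familySpace 𝓖 E, ∀ z' ∈ familySpace 𝓖 E,
      dist (F z) (F z') ≤ K * dist z z' ∧ dist z z' ≤ K * dist (F z) (F z'))
    {l : List ℕ} (hl : l.Nodup) {G : Finset ℕ} (hG : G ∈ 𝓖) (hlG : ∀ p ∈ l, p ∈ G) :
    AlmostBiLipschitz K 0 l.length x fun j => F (transplant l (x j)) := by
  intro i hi j hj
  have h := hF _ (transplant_mem_familySpace hE (hxE i) hG hlG)
    _ (transplant_mem_familySpace hE (hxE j) hG hlG)
  rw [dist_transplant hl (fun k hk => hx₀ i k (hi.le.trans hk))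
    fun k hk => hx₀ j k (hj.le.trans hk)] at h
  simpa only [add_zero] using h

-- An enumeration `l` is sent to the code of an approximation of `x j ↦ F (transplant l (x j))`.
theorem HasRankGE.refines (hE : 0 ∈ E) {x : ℕ → C₀(ℕ, ℝ)} (hxE : ∀ j i, x j i ∈ E)
    (hx₀ : ∀ j i, j ≤ i → x j i = 0) {d : ℕ → M} (hd : DenseRange d) {F : C₀(ℕ, ℝ) → M}
    (hF : ∀ z ∈ familySpace 𝓖 E, ∀ z' ∈ familySpace 𝓖 E,
      dist (F z) (F z') ≤ K * dist z z' ∧ dist z z' ≤ K * dist (F z) (F z'))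
    (h : HasRankGE (FamilyExtends 𝓖) α []) : HasRankGE (Refines x d K) α [] := by
  choose node hlen hnode using fun l : List ℕ =>
    exists_decode_dist_le hd (fun j => F (transplant l (x j))) l.length
      (pow_pos one_half_pos l.length : (0 : ℝ) < (1 / 2) ^ l.length)
  have hroot : node [] = [] := List.length_eq_zero_iff.1 (hlen [])
  rw [← hroot]
  refine h.map node fun l' l hl' => ?_
  obtain ⟨m, rfl, hnodup, G, hG, hsub⟩ := hl'
  refine refines_of_dist_le (y := fun j => F (transplant l (x j)))
    (y' := fun j => F (transplant (l ++ [m]) (x j))) ?_ ?_ ?_ ?_ ?_ <;> simp only [hlen]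
  · exact List.length_append
  · intro j hj
    rw [transplant_append_singleton fun i hi => hx₀ j i (hj.le.trans hi)]
  · exact hnode l
  · exact hnode (l ++ [m])
  · exact almostBiLipschitz_transplant hE hxE hx₀ hF hnodup hG hsub

theorem nonempty_familySpace (hE : 0 ∈ E) (h : HasRankGE (FamilyExtends 𝓖) 1 []) :
    (familySpace 𝓖 E).Nonempty := by
  obtain ⟨_, ⟨_, -, -, G, hG, -⟩, -⟩ := hasRankGE_iff.1 h 0 zero_lt_one
  exact ⟨0, G, hG, fun _ _ => hE, fun _ _ => rfl⟩

theorem exists_extend_of_lipschitzWith [Nonempty M] {X : Type*} [MetricSpace X] {s : Set X}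
    {f : s → M} (hf : LipschitzWith K f) (hf' : AntilipschitzWith K f) : ∃ F : X → M,
    ∀ z ∈ s, ∀ z' ∈ s, dist (F z) (F z') ≤ K * dist z z' ∧ dist z z' ≤ K * dist (F z) (F z') := by
  refine ⟨Function.extend (↑) f fun _ => Classical.arbitrary M, fun z hz z' hz' => ?_⟩
  lift z to s using hz
  lift z' to s using hz'
  simp only [Subtype.val_injective.extend_apply]
  exact ⟨hf.dist_le_mul z z', hf'.le_mul_dist z z'⟩

theorem c0_biLipschitzEmbeds_of_hasRankGE (M : Type*) [MetricSpace M] [CompleteSpace M]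
    [SeparableSpace M]
    (hM : ∀ α < ω₁, ∃ 𝓖 : Set (Finset ℕ), HasRankGE (FamilyExtends 𝓖) α [] ∧
      BiLipschitzEmbeds (familySpace 𝓖 (Set.range ((↑) : ℚ → ℝ))) M) :
    BiLipschitzEmbeds C₀(ℕ, ℝ) M := by
  have hzero : (0 : ℝ) ∈ Set.range ((↑) : ℚ → ℝ) := ⟨0, Rat.cast_zero⟩
  have : Nonempty M := by
    obtain ⟨𝓖, h𝓖, _, _, f, -⟩ := hM 1 (Ordinal.one_lt_omega0.trans_le (Ordinal.omega0_le_omega 1))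
    exact (nonempty_familySpace hzero h𝓖).to_subtype.map f
  obtain ⟨x, hx, hxQ, hx₀⟩ := exists_denseRange_rat_of_vanishing
  have hrank : ∀ α < ω₁, ∃ K : ℕ, HasRankGE (Refines x (denseSeq M) K) α [] := by
    intro α hα
    obtain ⟨𝓖, h𝓖, hembeds⟩ := hM α hα
    obtain ⟨K, f, hf, hf'⟩ := hembeds.exists_nat
    obtain ⟨F, hF⟩ := exists_extend_of_lipschitzWith hf hf'
    exact ⟨K, h𝓖.refines hzero hxQ hx₀ (denseRange_denseSeq M) hF⟩
  obtain ⟨K, hK⟩ := exists_forall_lt_omega_one_of_anti (fun _ _ _ hαβ h => h.anti hαβ) hrank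
  obtain ⟨p, hp₀, hp⟩ := exists_descending_chain_of_hasRankGE hK
  exact biLipschitzEmbeds_of_refines_chain hx hp₀ hp

end Universality

theorem theoremA (a : Ordinal.{0} → ℕ → Ordinal.{0}) (ha : IsLadderSystem a)
    (M : Type u) [MetricSpace M] [CompleteSpace M] [TopologicalSpace.SeparableSpace M]
    (hM : ∀ α : Ordinal.{0}, α < Ordinal.omega 1 → BiLipschitzEmbeds (schreierSpaceRat a α) M) :
    (∀ (X : Type v) [MetricSpace X] [TopologicalSpace.SeparableSpace X], BiLipschitzEmbeds X M) ∧
      BiLipschitzEmbeds C₀(ℕ, ℝ) M := by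
  have hc0 : BiLipschitzEmbeds C₀(ℕ, ℝ) M := c0_biLipschitzEmbeds_of_hasRankGE M fun α hα =>
    ⟨schreierFamily a α, hasRankGE_schreierFamily ha hα, hM α hα⟩
  exact ⟨fun X _ _ => (biLipschitzEmbeds_c0 X).trans hc0, hc0⟩
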